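/- Let $\mathcal P$ be a stream of $n$ points of $[0,1]$ (repetitions allowed), each labelled red or blue, and let $$D_c(\mathcal P)=\sup_{I=[p,q]\subseteq[0,1]}|R(I)-B(I)|$$ be its ($1$-dimensional) color discrepancy, where $R(I)$ and $B(I)$ are the numbers of red and of blue points of $\mathcal P$ in $I$. A randomized one-pass streaming algorithm returns an $(\epsilon,\rho)$-multiplicative solution to color discrepancy if on every input stream $\mathcal P$ its output $D$ satisfies $|D-D_c(\mathcal P)|\le\epsilon\,D_c(\mathcal P)$ with probability at least $1-\rho$. Theorem. For every $\rho$ with $0\le\rho<\frac12$ there are a constant $c>0$ and an integer $n_0$, depending only on $\rho$, such that the following holds for all $n\ge n_0$, all $\epsilon$ with $0<\epsilon<\frac15$, and every universe $U\subseteq[0,1]$ with at least $n$ elements: every randomized one-pass streaming algorithm that returns an $(\epsilon,\rho)$-multiplicative solution to color discrepancy for all streams of $n$ labelled points of $U$ uses at least $c\,n$ bits of memory. In short, any such algorithm needs $\Omega(n)$ bits of space. Here the algorithm may be non-uniform: it may know $n$ and $U$, it has free access to its random coins and to the number of items read so far, and only the memory kept between consecutive items is counted. -/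

import Mathlib

namespace ColorStream

/-- The two possible labels of a point. -/
inductive Label where
  | red
  | blue

/-- The items of a stream whose points come from the universe `U`: a point with its label. -/
abbrev Item (U : Set ℝ) : Type := U × Label

open Classical in
/-- The number of points of the stream `P` (with multiplicity) that carry the label `l` and lie in
the interval `[p, q]`. -/
noncomputable def labelCount {U : Set ℝ} (P : List (Item U)) (l : Label) (p q : ℝ) : ℕ :=
  P.countP fun x => decide (x.2 = l ∧ (x.1 : ℝ) ∈ Set.Icc p q)

/-- The color discrepancy `sup |R(I) - B(I)|` over the intervals `I = [p, q] ⊆ [0, 1]`.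
The set is non-empty and bounded by the length of `P`, so this is a genuine supremum. -/
noncomputable def colorDisc {U : Set ℝ} (P : List (Item U)) : ℝ :=
  sSup {d : ℝ | ∃ p q : ℝ, 0 ≤ p ∧ p ≤ q ∧ q ≤ 1 ∧
    d = |(labelCount P Label.red p q : ℝ) - (labelCount P Label.blue p q : ℝ)|}

/-- The contents of a memory of `s` bits. -/
abbrev Memory (s : ℕ) : Type := Fin s → Bool

/-- A randomized one-pass streaming algorithm with items in `X`, random outcomes in `Ω`, `s` bits
of memory and a real output. For a fixed outcome `ω` it is deterministic; `step ω t m x` is the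
memory after the item number `t` (counted from `0`) with value `x` has been read with memory `m`.
Neither the random outcome nor the clock `t` is charged for, and nothing is required of the
computability of the maps. Fresh coins in every step are covered: let `ω` be the sequence of all
coins and let `step ω t` look at those of time `t` only. -/
structure StreamAlgorithm (Ω X : Type*) (s : ℕ) where
  init : Ω → Memory s
  step : Ω → ℕ → Memory s → X → Memory s
  output : Ω → Memory s → ℝ

namespace StreamAlgorithm

variable {Ω X : Type*} {s : ℕ}

/-- The memory after reading a list of items, when `t` items have been read before it and the
memory is `m`. -/
def runFrom (A : StreamAlgorithm Ω X s) (ω : Ω) : ℕ → Memory s → List X → Memory s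
  | _, m, [] => m
  | t, m, x :: xs => A.runFrom ω (t + 1) (A.step ω t m x) xs

/-- The output of the algorithm after its single pass over the stream `P`. -/
def result (A : StreamAlgorithm Ω X s) (P : List X) (ω : Ω) : ℝ :=
  A.output ω (A.runFrom ω 0 (A.init ω) P)

end StreamAlgorithm

/-- The algorithm `A` returns an `(ε, ρ)`-multiplicative solution to color discrepancy on all
streams of `n` points of the universe `U`: on each of them its output `D` is a random variable and
`|D - D_c(P)| ≤ ε * D_c(P)` holds with probability at least `1 - ρ`. -/
def IsMultiplicativeSolution {Ω : Type*} [MeasurableSpace Ω] {U : Set ℝ} {s : ℕ}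
    (μ : MeasureTheory.Measure Ω) (A : StreamAlgorithm Ω (Item U) s) (n : ℕ) (ε ρ : ℝ) : Prop :=
  ∀ P : List (Item U), P.length = n →
    Measurable (A.result P) ∧
      1 - ρ ≤ μ.real {ω | |A.result P ω - colorDisc P| ≤ ε * colorDisc P}

end ColorStream

/-! The proof reduces from one-way indexing. The letters of a word of length `m` become the label
orders in `m` disjoint pairs of neighbouring points. A prefix of the line then has weight (red minus
blue) `±1` if it separates a pair, and `0` otherwise. To ask for letter `i`, a red-first pair is
added at place `i` and a blue-first pair at the far right. If the letter is `true`, prefix weights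
reach both `2` and `-1`, so the discrepancy is at least `3` (`three_le_colorDisc_of_letter_true`);
otherwise they stay in `[-1, 1]` and it is at most `2` (`colorDisc_le_two_of_letter_false`). A
relative error below `1/5` separates the two cases, so the memory after the word reveals any one
letter with error probability at most `ρ`. Averaging fixes the coins (`exists_sum_indicator_le`),
and an exponential-moment count bounds the resulting deterministic code
(`memory_bound_of_average_error`). -/

namespace ColorStream

open MeasureTheory

/-! ### Average-error bound for the indexing problem. -/

section Indexing

/-- The generating function of the Hamming distance to a fixed word. -/
theorem sum_exp_neg_hammingDist {m : ℕ} (lam : ℝ) (y : Fin m → Bool) :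
    ∑ x : Fin m → Bool, Real.exp (-(lam * hammingDist y x)) = (1 + Real.exp (-lam)) ^ m := by
  have h : ∀ x : Fin m → Bool, Real.exp (-(lam * hammingDist y x)) =
      ∏ i, (if y i ≠ x i then Real.exp (-lam) else 1) := by
    intro x
    rw [Finset.prod_ite]
    simp only [Finset.prod_const, one_pow, mul_one, ← Real.exp_nat_mul, hammingDist]
    ring_nf
  simp_rw [h]
  have h2 := Finset.prod_univ_sum (fun _ : Fin m => (Finset.univ : Finset Bool))
    (fun i b => if y i ≠ b then Real.exp (-lam) else 1)
  rw [Fintype.piFinset_univ] at h2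
  rw [← h2]
  have h3 : ∀ i : Fin m, (∑ b : Bool, if y i ≠ b then Real.exp (-lam) else 1) =
      1 + Real.exp (-lam) := by
    intro i
    cases y i <;> simp [add_comm]
  simp only [h3, Finset.prod_const, Finset.card_univ, Fintype.card_fin]

/-- A code of `m`-bit words into `s`-bit memories whose decoder errs on a fraction of at most
`ρ < 1/2` of all pairs of a word and a position has `s ≥ 2 (1/2 - ρ)² m`. -/
theorem memory_bound_of_average_error {m s : ℕ} {ρ : ℝ} (hρ : ρ < 1 / 2)
    (enc : (Fin m → Bool) → Memory s) (dec : Memory s → Fin m → Bool)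
    (h : ∑ x, (hammingDist (dec (enc x)) x : ℝ) ≤ ρ * m * 2 ^ m) :
    2 * (1 / 2 - ρ) ^ 2 * m ≤ s := by
  -- This value maximizes the final exponent `lam * (1 / 2 - ρ) - lam ^ 2 / 8`.
  set lam : ℝ := 4 * (1 / 2 - ρ) with hlam
  have hlam0 : 0 ≤ lam := by linarith
  have upper : ∑ x, Real.exp (-(lam * hammingDist (dec (enc x)) x)) ≤
      2 ^ s * (1 + Real.exp (-lam)) ^ m := by
    calc ∑ x, Real.exp (-(lam * hammingDist (dec (enc x)) x))
        ≤ ∑ x, ∑ M : Memory s, Real.exp (-(lam * hammingDist (dec M) x)) := by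
          refine Finset.sum_le_sum fun x _ => ?_
          exact Finset.single_le_sum
            (f := fun M : Memory s => Real.exp (-(lam * hammingDist (dec M) x)))
            (fun _ _ => (Real.exp_pos _).le) (Finset.mem_univ (enc x))
      _ = ∑ M : Memory s, ∑ x, Real.exp (-(lam * hammingDist (dec M) x)) := Finset.sum_comm
      _ = 2 ^ s * (1 + Real.exp (-lam)) ^ m := by
          simp [sum_exp_neg_hammingDist]
  have lower : Real.exp (-(lam * (ρ * m))) * 2 ^ m ≤
      ∑ x, Real.exp (-(lam * hammingDist (dec (enc x)) x)) := by
    -- Jensen's inequality by hand: the exponential lies above its tangent at the error bound `ρ *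
    -- m`.
    have tangent : ∀ x, Real.exp (-(lam * (ρ * m))) *
        (1 + lam * (ρ * m) - lam * hammingDist (dec (enc x)) x) ≤
        Real.exp (-(lam * hammingDist (dec (enc x)) x)) := by
      intro x
      have h1 := Real.add_one_le_exp (lam * (ρ * m) - lam * hammingDist (dec (enc x)) x)
      calc _ ≤ Real.exp (-(lam * (ρ * m))) *
            Real.exp (lam * (ρ * m) - lam * hammingDist (dec (enc x)) x) := by
            gcongr
            linarith
        _ = _ := by rw [← Real.exp_add]; congr 1; ring
    refine le_trans ?_ (Finset.sum_le_sum fun x _ => tangent x)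
    rw [← Finset.mul_sum]
    gcongr
    rw [Finset.sum_sub_distrib, ← Finset.mul_sum]
    simp only [Finset.sum_const, Finset.card_univ, Fintype.card_pi, Fintype.card_bool,
      Finset.prod_const, Fintype.card_fin, nsmul_eq_mul]
    push_cast
    nlinarith [mul_le_mul_of_nonneg_left h hlam0]
  have cosh_bound : 1 + Real.exp (-lam) ≤ 2 * Real.exp (-(lam / 2) + lam ^ 2 / 8) := by
    have h1 := Real.cosh_le_exp_half_sq (lam / 2)
    rw [Real.cosh_eq] at h1
    have h2 : Real.exp (-(lam / 2)) * Real.exp (lam / 2) = 1 := by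
      rw [← Real.exp_add]; simp
    have h3 : Real.exp (-(lam / 2)) * Real.exp (-(lam / 2)) = Real.exp (-lam) := by
      rw [← Real.exp_add]; congr 1; ring
    have h4 : (lam / 2) ^ 2 / 2 = lam ^ 2 / 8 := by ring
    rw [h4] at h1
    rw [Real.exp_add]
    nlinarith [mul_le_mul_of_nonneg_left h1 (Real.exp_pos (-(lam / 2))).le]
  have key : Real.exp (-(lam * (ρ * m))) * 2 ^ m ≤
      2 ^ s * (2 ^ m * Real.exp (m * (-(lam / 2) + lam ^ 2 / 8))) := by
    refine lower.trans (upper.trans ?_)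
    rw [Real.exp_nat_mul, ← mul_pow]
    gcongr
  have key2 : Real.exp (2 * (1 / 2 - ρ) ^ 2 * m) ≤ 2 ^ s := by
    have h5 : Real.exp (2 * (1 / 2 - ρ) ^ 2 * m) = Real.exp (-(lam * (ρ * m))) /
        Real.exp (m * (-(lam / 2) + lam ^ 2 / 8)) := by
      rw [← Real.exp_sub]; congr 1; rw [hlam]; ring
    rw [h5, div_le_iff₀ (Real.exp_pos _)]
    have h6 : (0 : ℝ) < 2 ^ m := by positivity
    refine le_of_mul_le_mul_right ?_ h6
    linarith
  have key3 : (2 : ℝ) ^ s ≤ Real.exp s := by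
    have h7 := Real.add_one_le_exp (1 : ℝ)
    calc (2 : ℝ) ^ s ≤ Real.exp 1 ^ s := by gcongr; linarith
      _ = Real.exp s := by rw [← Real.exp_nat_mul, mul_one]
  exact Real.exp_le_exp.1 (key2.trans key3)

end Indexing

/-! ### Signed weights and discrepancy. -/

section Weight

variable {U : Set ℝ}

/-- Red counts `1` and blue counts `-1`. -/
def Label.sign : Label → ℤ
  | .red => 1
  | .blue => -1

open Classical in
/-- The number of red points minus the number of blue points of the stream `P` in `S`. -/
noncomputable def weight (S : Set ℝ) (P : List (Item U)) : ℤ :=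
  (P.map fun x => if (x.1 : ℝ) ∈ S then x.2.sign else 0).sum

theorem weight_nil (S : Set ℝ) : weight S ([] : List (Item U)) = 0 := rfl

open Classical in
theorem weight_cons (S : Set ℝ) (x : Item U) (P : List (Item U)) :
    weight S (x :: P) = (if (x.1 : ℝ) ∈ S then x.2.sign else 0) + weight S P := by
  simp [weight]

theorem weight_append (S : Set ℝ) (P Q : List (Item U)) :
    weight S (P ++ Q) = weight S P + weight S Q := by
  simp [weight]

theorem weight_flatten (S : Set ℝ) (Ps : List (List (Item U))) :
    weight S Ps.flatten = (Ps.map (weight S)).sum := by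
  induction Ps with
  | nil => rfl
  | cons P Ps ih => simp [weight_append, ih]

theorem labelCount_red_sub_blue (P : List (Item U)) (p q : ℝ) :
    (labelCount P Label.red p q : ℤ) - labelCount P Label.blue p q =
      weight (Set.Icc p q) P := by
  classical
  induction P with
  | nil => simp [labelCount, weight_nil]
  | cons x P ih =>
    rw [weight_cons, ← ih]
    obtain ⟨x, l⟩ := x
    unfold labelCount
    by_cases hx : (x : ℝ) ∈ Set.Icc p q <;> cases l <;>
      simp [-Set.mem_Icc, hx, Label.sign] <;> ring

theorem weight_diff (P : List (Item U)) {S S' : Set ℝ} (h : S' ⊆ S) :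
    weight (S \ S') P = weight S P - weight S' P := by
  induction P with
  | nil => simp [weight_nil]
  | cons x P ih =>
    rw [weight_cons, weight_cons, weight_cons, ih]
    by_cases h₁ : (x.1 : ℝ) ∈ S'
    · simp [h₁, h h₁]
    · by_cases h₂ : (x.1 : ℝ) ∈ S <;> simp [h₁, h₂, add_sub_assoc]

theorem weight_Icc (P : List (Item U)) {p q : ℝ} (hpq : p ≤ q) :
    weight (Set.Icc p q) P = weight (Set.Iic q) P - weight (Set.Iio p) P := by
  have h : Set.Iio p ⊆ Set.Iic q := fun r hr => (le_of_lt hr).trans hpq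
  rw [← weight_diff P h]
  congr 1
  ext r
  simp

theorem abs_labelCount_red_sub_blue (P : List (Item U)) {p q : ℝ} (hpq : p ≤ q) :
    |(labelCount P Label.red p q : ℝ) - (labelCount P Label.blue p q : ℝ)| =
      ((|weight (Set.Iic q) P - weight (Set.Iio p) P| : ℤ) : ℝ) := by
  rw [← weight_Icc P hpq, ← labelCount_red_sub_blue]
  push_cast
  rfl

/-- An interval is a difference of two lower sets, so bounds on prefixes suffice. -/
theorem colorDisc_le_two {P : List (Item U)}
    (h : ∀ S : Set ℝ, IsLowerSet S → |weight S P| ≤ 1) : colorDisc P ≤ 2 := by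
  refine csSup_le ⟨_, 0, 0, le_rfl, le_rfl, zero_le_one, rfl⟩ ?_
  rintro d ⟨p, q, -, hpq, -, rfl⟩
  rw [abs_labelCount_red_sub_blue P hpq]
  have h1 := abs_le.1 (h _ (isLowerSet_Iic q))
  have h2 := abs_le.1 (h _ (isLowerSet_Iio p))
  have h3 : |weight (Set.Iic q) P - weight (Set.Iio p) P| ≤ 2 := abs_le.2 (by omega)
  exact_mod_cast h3

theorem abs_weight_sub_le_colorDisc (P : List (Item U)) {p q : ℝ} (hp : 0 ≤ p) (hpq : p ≤ q)
    (hq : q ≤ 1) :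
    ((|weight (Set.Iic q) P - weight (Set.Iio p) P| : ℤ) : ℝ) ≤ colorDisc P := by
  rw [← abs_labelCount_red_sub_blue P hpq]
  refine le_csSup ⟨P.length, ?_⟩ ⟨p, q, hp, hpq, hq, rfl⟩
  rintro d ⟨p, q, -, -, -, rfl⟩
  have h1 : (labelCount P Label.red p q : ℝ) ≤ P.length := by
    exact_mod_cast List.countP_le_length
  have h2 : (labelCount P Label.blue p q : ℝ) ≤ P.length := by
    exact_mod_cast List.countP_le_length
  exact abs_le.2 ⟨by linarith [(labelCount P Label.red p q).cast_nonneg (α := ℝ)],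
    by linarith [(labelCount P Label.blue p q).cast_nonneg (α := ℝ)]⟩

end Weight

/-! ### The hard streams. -/

section Encoding

variable {U : Set ℝ} {m : ℕ}

/-- Two points with different labels, the first one red if and only if `b` holds. -/
def pairStream (v : ℕ → U) (j : ℕ) (b : Bool) : List (Item U) :=
  [(v (2 * j), if b then .red else .blue), (v (2 * j + 1), if b then .blue else .red)]

/-- The stream that encodes the word `x` by the order of the labels in consecutive pairs. -/
def wordStream (v : ℕ → U) (x : Fin m → Bool) : List (Item U) :=
  (List.ofFn fun j : Fin m => pairStream v j (x j)).flatten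

/-- The stream that asks for the letter number `i` of a word of length `m`; it has an additional
point if `odd` holds. -/
def queryStream (v : ℕ → U) (m i : ℕ) (odd : Bool) : List (Item U) :=
  pairStream v i true ++ pairStream v m false ++
    if odd then [(v (2 * m + 1), .blue)] else []

theorem length_wordStream (v : ℕ → U) (x : Fin m → Bool) :
    (wordStream v x).length = 2 * m := by
  simp [wordStream, pairStream, List.length_flatten, List.map_ofFn, Function.comp_def,
    mul_comm]

theorem length_queryStream (v : ℕ → U) (m i : ℕ) (odd : Bool) :
    (queryStream v m i odd).length = 4 + odd.toNat := by
  cases odd <;> simp [queryStream, pairStream]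

/-- A lower set cuts a strictly increasing finite sequence at one place. -/
theorem exists_cut {v : ℕ → U} {n : ℕ} (hv : StrictMonoOn v (Set.Iio n)) {S : Set ℝ}
    (hS : IsLowerSet S) : ∃ T, ∀ k < n, (v k : ℝ) ∈ S ↔ k < T := by
  classical
  -- The alternative `n ≤ T` covers a lower set containing the whole sequence.
  have hex : ∃ T, n ≤ T ∨ (v T : ℝ) ∉ S := ⟨n, Or.inl le_rfl⟩
  refine ⟨Nat.find hex, fun k hk => ⟨fun hkS => ?_, fun hkT => ?_⟩⟩
  · by_contra hlt
    have hle := not_lt.1 hlt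
    rcases Nat.find_spec hex with h | h
    · omega
    · exact h (hS (hv.monotoneOn (lt_of_le_of_lt hle hk) hk hle) hkS)
  · have := Nat.find_min hex hkT
    push Not at this
    exact this.2

section Cut

variable {v : ℕ → U} {S : Set ℝ} {T : ℕ} (hT : ∀ k < 2 * m + 2, (v k : ℝ) ∈ S ↔ k < T)

include hT

/-- The two labels cancel unless the cut falls between the two points. -/
theorem weight_pairStream {j : ℕ} (hj : j ≤ m) (b : Bool) :
    weight S (pairStream v j b) = if T = 2 * j + 1 then (if b then 1 else -1) else 0 := by
  rw [pairStream, weight_cons, weight_cons, weight_nil]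
  simp only [hT (2 * j) (by omega), hT (2 * j + 1) (by omega)]
  cases b <;> simp only [Label.sign] <;> split_ifs <;> first | rfl | omega

theorem weight_wordStream (x : Fin m → Bool) :
    weight S (wordStream v x) =
      ∑ j : Fin m, if T = 2 * (j : ℕ) + 1 then (if x j then 1 else -1) else 0 := by
  rw [wordStream, weight_flatten, List.map_ofFn, List.sum_ofFn]
  exact Finset.sum_congr rfl fun j _ => weight_pairStream hT j.2.le _

theorem weight_wordStream_of_eq (x : Fin m → Bool) (j : Fin m) (hj : T = 2 * (j : ℕ) + 1) :
    weight S (wordStream v x) = if x j then 1 else -1 := by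
  rw [weight_wordStream hT, Finset.sum_eq_single j]
  · simp [hj]
  · intro k _ hk
    rw [if_neg]
    intro h
    exact hk (Fin.ext (by omega))
  · simp

theorem weight_wordStream_of_ne (x : Fin m → Bool) (hj : ∀ j < m, T ≠ 2 * j + 1) :
    weight S (wordStream v x) = 0 := by
  rw [weight_wordStream hT]
  exact Finset.sum_eq_zero fun j _ => if_neg (hj j j.2)

theorem weight_queryStream {i : ℕ} (hi : i < m) (odd : Bool) :
    weight S (queryStream v m i odd) = (if T = 2 * i + 1 then 1 else 0) +
      (if T = 2 * m + 1 then -1 else 0) + if odd ∧ 2 * m + 1 < T then -1 else 0 := by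
  rw [queryStream, weight_append, weight_append, weight_pairStream hT hi.le,
    weight_pairStream hT le_rfl]
  cases odd
  · simp [weight_nil]
  · simp [weight_cons, weight_nil, hT (2 * m + 1) (by omega), Label.sign]

end Cut

variable {v : ℕ → U} (hv : StrictMonoOn v (Set.Iio (2 * m + 2)))

include hv

/-- Inside pair `i` the query's `+1` cancels the letter's `-1`; at every other cut at most one part
contributes. -/
theorem colorDisc_le_two_of_letter_false (x : Fin m → Bool) (i : Fin m) (odd : Bool)
    (hx : x i = false) : colorDisc (wordStream v x ++ queryStream v m i odd) ≤ 2 := by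
  refine colorDisc_le_two fun S hS => ?_
  obtain ⟨T, hT⟩ := exists_cut hv hS
  rw [weight_append, weight_queryStream hT i.2]
  by_cases hj : ∃ j : Fin m, T = 2 * (j : ℕ) + 1
  · obtain ⟨j, hj⟩ := hj
    rw [weight_wordStream_of_eq hT x j hj, if_neg (by omega : ¬ T = 2 * m + 1),
      if_neg (by omega : ¬ (odd = true ∧ 2 * m + 1 < T))]
    by_cases hij : j = i
    · subst hij
      simp [hx, hj]
    · have hij' : ¬ (T = 2 * (i : ℕ) + 1) := fun h => hij (Fin.ext (by omega))
      rw [if_neg hij']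
      cases x j <;> simp
  · push Not at hj
    rw [weight_wordStream_of_ne hT x fun j h => hj ⟨j, h⟩, if_neg (hj i), abs_le]
    split_ifs <;> omega

/-- The witness runs from the second point of pair `i` to the first point of pair `m`, where the
prefix weight falls from `2` to `-1`. -/
theorem three_le_colorDisc_of_letter_true (hU : U ⊆ Set.Icc 0 1) (x : Fin m → Bool) (i : Fin m)
    (odd : Bool) (hx : x i = true) :
    3 ≤ colorDisc (wordStream v x ++ queryStream v m i odd) := by
  have hi := i.2
  have hmem : ∀ {k}, k < 2 * m + 2 → k ∈ Set.Iio (2 * m + 2) := fun h => h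
  have hle : (v (2 * i + 1) : ℝ) ≤ v (2 * m) :=
    hv.monotoneOn (hmem (by omega)) (hmem (by omega)) (by omega)
  have hT₁ : ∀ k < 2 * m + 2, (v k : ℝ) ∈ Set.Iic (v (2 * m) : ℝ) ↔ k < 2 * m + 1 := by
    intro k hk
    rw [Set.mem_Iic, Subtype.coe_le_coe, hv.le_iff_le (hmem hk) (hmem (by omega))]
    omega
  have hT₂ : ∀ k < 2 * m + 2, (v k : ℝ) ∈ Set.Iio (v (2 * i + 1) : ℝ) ↔ k < 2 * (i : ℕ) + 1 := by
    intro k hk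
    rw [Set.mem_Iio, Subtype.coe_lt_coe, hv.lt_iff_lt (hmem hk) (hmem (by omega))]
  have h := abs_weight_sub_le_colorDisc (wordStream v x ++ queryStream v m i odd)
    (hU (v (2 * i + 1)).2).1 hle (hU (v (2 * m)).2).2
  have h₁ : weight (Set.Iic (v (2 * m) : ℝ)) (wordStream v x ++ queryStream v m i odd) = -1 := by
    rw [weight_append, weight_queryStream hT₁ hi,
      weight_wordStream_of_ne hT₁ x fun j hj => by omega, if_neg (by omega), if_pos rfl,
      if_neg (by omega)]
    rfl
  have h₂ : weight (Set.Iio (v (2 * i + 1) : ℝ))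
      (wordStream v x ++ queryStream v m i odd) = 2 := by
    rw [weight_append, weight_queryStream hT₂ hi, weight_wordStream_of_eq hT₂ x i rfl,
      if_pos hx, if_pos rfl, if_neg (by omega), if_neg (by omega)]
    rfl
  rw [h₁, h₂] at h
  norm_num at h
  exact h

end Encoding

/-! ### From streaming algorithms to codes. -/

section Algorithm

theorem StreamAlgorithm.runFrom_append {Ω X : Type*} {s : ℕ} (A : StreamAlgorithm Ω X s) (ω : Ω)
    (P Q : List X) : ∀ (t : ℕ) (M : Memory s), A.runFrom ω t M (P ++ Q) =
      A.runFrom ω (t + P.length) (A.runFrom ω t M P) Q := by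
  induction P with
  | nil => intro t M; rfl
  | cons x P ih =>
    intro t M
    simp only [List.cons_append, StreamAlgorithm.runFrom, ih, List.length_cons]
    congr 1
    omega

theorem exists_strictMonoOn_of_le_encard {U : Set ℝ} {n : ℕ} (hn : 0 < n)
    (h : (n : ℕ∞) ≤ U.encard) : ∃ v : ℕ → U, StrictMonoOn v (Set.Iio n) := by
  obtain ⟨t, htU, ht⟩ := Set.exists_subset_encard_eq h
  have hfin : t.Finite := Set.finite_of_encard_eq_coe ht
  have hcard : hfin.toFinset.card = n := by
    rw [← Set.ncard_eq_toFinset_card t hfin, Set.ncard, ht, ENat.toNat_natCast]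
  have hmem : ∀ k, hfin.toFinset.orderEmbOfFin hcard k ∈ U := fun k =>
    htU (hfin.mem_toFinset.1 (Finset.orderEmbOfFin_mem _ hcard k))
  refine ⟨fun k => ⟨hfin.toFinset.orderEmbOfFin hcard
    (if hk : k < n then ⟨k, hk⟩ else ⟨0, hn⟩), hmem _⟩, ?_⟩
  intro a ha b hb hab
  rw [Set.mem_Iio] at ha hb
  simp only [dif_pos ha, dif_pos hb, Subtype.mk_lt_mk]
  exact (OrderEmbedding.lt_iff_lt _).2 hab

/-- If each of finitely many events has probability at most `ρ`, then some outcome lies in at most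
a fraction `ρ` of them. -/
theorem exists_sum_indicator_le {Ω ι : Type*} [Fintype ι] [MeasurableSpace Ω] (μ : Measure Ω)
    [IsProbabilityMeasure μ] (E : ι → Set Ω) (hE : ∀ i, MeasurableSet (E i)) {ρ : ℝ}
    (h : ∀ i, μ.real (E i) ≤ ρ) :
    ∃ ω, ∑ i, (E i).indicator (1 : Ω → ℝ) ω ≤ ρ * Fintype.card ι := by
  have hint : ∀ i, Integrable ((E i).indicator (1 : Ω → ℝ)) μ := fun i =>
    (integrable_const (1 : ℝ)).indicator (hE i)
  obtain ⟨ω, hω⟩ := exists_le_integral (μ := μ)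
    (integrable_finsetSum Finset.univ fun i _ => hint i)
  refine ⟨ω, hω.trans ?_⟩
  rw [integral_finsetSum _ fun i _ => hint i]
  calc ∑ i, ∫ ω, (E i).indicator (1 : Ω → ℝ) ω ∂μ ≤ ∑ _i : ι, ρ := by
        refine Finset.sum_le_sum fun i _ => ?_
        rw [integral_indicator_one (hE i)]
        exact h i
    _ = ρ * Fintype.card ι := by simp [mul_comm]

/-- An accurate output exceeds `12/5` if and only if the discrepancy is at least `3` rather than
at most `2`. -/
theorem twelve_fifths_lt_iff {ε d D : ℝ} (hε₀ : 0 < ε) (hε : ε < 1 / 5) (h : |D - d| ≤ ε * d)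
    {b : Bool} (hfalse : b = false → d ≤ 2) (htrue : b = true → 3 ≤ d) :
    12 / 5 < D ↔ b = true := by
  -- The threshold is `2 * (1 + 1 / 5) = 12 / 5 = 3 * (1 - 1 / 5)`.
  rw [abs_le] at h
  cases b
  · have hd := hfalse rfl
    simp only [Bool.false_eq_true, iff_false, not_lt]
    nlinarith
  · have hd := htrue rfl
    simp only [iff_true]
    nlinarith

theorem memory_bound {ρ : ℝ} (hρ : ρ < 1 / 2) {m : ℕ} {odd : Bool} {ε : ℝ} (hε₀ : 0 < ε)
    (hε : ε < 1 / 5) {U : Set ℝ} (hU : U ⊆ Set.Icc 0 1) {v : ℕ → U}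
    (hv : StrictMonoOn v (Set.Iio (2 * m + 2))) {Ω : Type*} [MeasurableSpace Ω]
    (μ : Measure Ω) [IsProbabilityMeasure μ] {s : ℕ} (A : StreamAlgorithm Ω (Item U) s)
    (hA : IsMultiplicativeSolution μ A (2 * m + (4 + odd.toNat)) ε ρ) :
    2 * (1 / 2 - ρ) ^ 2 * m ≤ s := by
  classical
  let P : (Fin m → Bool) × Fin m → List (Item U) := fun z =>
    wordStream v z.1 ++ queryStream v m z.2 odd
  have hP : ∀ z, (P z).length = 2 * m + (4 + odd.toNat) := fun z => by
    rw [List.length_append, length_wordStream, length_queryStream]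
  let good : (Fin m → Bool) × Fin m → Set Ω := fun z =>
    {ω | |A.result (P z) ω - colorDisc (P z)| ≤ ε * colorDisc (P z)}
  have hmeas : ∀ z, MeasurableSet (good z) := fun z =>
    measurableSet_le (by simpa only [Real.norm_eq_abs] using
      ((hA (P z) (hP z)).1.sub_const (colorDisc (P z))).norm) measurable_const
  obtain ⟨ω, hω⟩ := exists_sum_indicator_le μ (fun z => (good z)ᶜ)
    (fun z => (hmeas z).compl) (ρ := ρ) (fun z => by
      rw [probReal_compl_eq_one_sub (hmeas z)]
      linarith [(hA (P z) (hP z)).2])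
  let enc : (Fin m → Bool) → Memory s := fun x => A.runFrom ω 0 (A.init ω) (wordStream v x)
  -- The clock reads `2 * m` after every word, so the decoder needs no further information.
  let dec : Memory s → Fin m → Bool := fun M i =>
    decide (12 / 5 < A.output ω (A.runFrom ω (2 * m) M (queryStream v m i odd)))
  refine memory_bound_of_average_error hρ enc dec ?_
  have hdec : ∀ x i, dec (enc x) i = decide (12 / 5 < A.result (P (x, i)) ω) := by
    intro x i
    simp only [dec, enc, P, StreamAlgorithm.result, StreamAlgorithm.runFrom_append,
      length_wordStream, zero_add]
  have herr : ∀ x i, (if dec (enc x) i ≠ x i then (1 : ℝ) else 0) ≤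
      ((good (x, i))ᶜ).indicator (1 : Ω → ℝ) ω := by
    intro x i
    by_cases hg : ω ∈ good (x, i)
    · have := twelve_fifths_lt_iff hε₀ hε hg
        (colorDisc_le_two_of_letter_false hv x i odd)
        (three_le_colorDisc_of_letter_true hv hU x i odd)
      rw [if_neg]
      · exact Set.indicator_nonneg (fun _ _ => zero_le_one) _
      · rw [not_not, hdec, Bool.eq_iff_iff, decide_eq_true_iff]
        exact this
    · rw [Set.indicator_of_mem (Set.mem_compl hg)]
      split_ifs <;> simp
  calc ∑ x, (hammingDist (dec (enc x)) x : ℝ)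
      = ∑ x, ∑ i, if dec (enc x) i ≠ x i then (1 : ℝ) else 0 := by
        refine Finset.sum_congr rfl fun x _ => ?_
        rw [Finset.sum_boole]
        rfl
    _ ≤ ∑ x, ∑ i, ((good (x, i))ᶜ).indicator (1 : Ω → ℝ) ω :=
        Finset.sum_le_sum fun x _ => Finset.sum_le_sum fun i _ => herr x i
    _ ≤ ρ * Fintype.card ((Fin m → Bool) × Fin m) := by
        rw [← Fintype.sum_prod_type']
        exact hω
    _ = ρ * m * 2 ^ m := by
        simp
        ring

end Algorithm

end ColorStream

theorem mainTheorem11 (ρ : ℝ) (hρ₀ : 0 ≤ ρ) (hρ : ρ < 1 / 2) :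
    ∃ (c : ℝ) (n₀ : ℕ), 0 < c ∧
      ∀ (n : ℕ), n₀ ≤ n → ∀ (ε : ℝ), 0 < ε → ε < 1 / 5 →
      ∀ (U : Set ℝ), U ⊆ Set.Icc 0 1 → (n : ℕ∞) ≤ U.encard →
      ∀ (Ω : Type*) [MeasurableSpace Ω] (μ : MeasureTheory.Measure Ω)
        [MeasureTheory.IsProbabilityMeasure μ] (s : ℕ)
        (A : ColorStream.StreamAlgorithm Ω (ColorStream.Item U) s),
        ColorStream.IsMultiplicativeSolution μ A n ε ρ → c * (n : ℝ) ≤ (s : ℝ) := by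
  -- From `n ≥ 10` follows `n ≤ 4 * m`, which turns `2 * (1 / 2 - ρ) ^ 2 * m` into this constant
  -- times `n`.
  refine ⟨(1 / 2 - ρ) ^ 2 / 2, 10, by nlinarith, ?_⟩
  intro n hn ε hε₀ hε U hU hcard Ω _ μ _ s A hA
  obtain ⟨m, odd, hm⟩ : ∃ (m : ℕ) (odd : Bool), n = 2 * m + (4 + odd.toNat) := by
    rcases Nat.even_or_odd' n with ⟨k, hk | hk⟩
    · exact ⟨k - 2, false, by simp; omega⟩
    · exact ⟨k - 2, true, by simp; omega⟩
  obtain ⟨v, hv⟩ := ColorStream.exists_strictMonoOn_of_le_encard (by omega) hcard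
  have hv' : StrictMonoOn v (Set.Iio (2 * m + 2)) :=
    hv.mono (Set.Iio_subset_Iio (by omega))
  have hodd : odd.toNat ≤ 1 := Bool.toNat_le odd
  have hmn : (n : ℝ) ≤ 4 * m := by
    have : n ≤ 4 * m := by omega
    exact_mod_cast this
  have h := ColorStream.memory_bound hρ hε₀ hε hU hv' μ A (hm ▸ hA)
  nlinarith [sq_nonneg (1 / 2 - ρ)]
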